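/- A Schröder path of semi-length $n$ is a lattice path from $(0,0)$ to $(2n,0)$ with steps $U=(1,1)$, $D=(1,-1)$, $H=(2,0)$ that never goes below the $x$-axis. Let $\mathcal S_n$ be the set of Schröder paths of semi-length $n$, partially ordered by $\gamma_1\le\gamma_2$ if and only if $\gamma_1$ lies weakly below $\gamma_2$. For a finite poset $P$ let $\ell(P)$ be the number of edges of its Hasse diagram (pairs $x,y$ such that $y$ covers $x$), and let $i(P)=\ell(P)/|P|$ be its Hasse index. Let $d_n=\sum_{k=0}^n\binom nk\binom{n+k}k$ be the central Delannoy numbers and $r_n$ the large Schröder numbers ($r_0=1$, $r_{n+1}=r_n+\sum_{i=0}^n r_ir_{n-i}$), with generating series $d(x)=\sum_{n\ge0}d_nx^n$ and $r(x)=\sum_{n\ge0}r_nx^n$; put $d_{-1}=r_{-1}=0$. Let $\left(\!\binom mk\!\right)=\frac{m(m+1)\cdots(m+k-1)}{k!}$ be the multiset coefficients. As usual $a_n\sim b_n$ means $a_n/b_n\to1$ as $n\to\infty$. **Theorem.** The edge generating series $\ell_{\mathcal S}(x)=\sum_{n\ge0}\ell(\mathcal S_n)x^n$ of the Schröder lattices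 is $$\ell_{\mathcal S}(x)=(1-x)\,(d(x)-r(x))=\frac{(1-x)\left(1-4x+x^2-(1-x)\sqrt{1-6x+x^2}\right)}{2x\sqrt{1-6x+x^2}},$$ where $\sqrt{1-6x+x^2}$ is the formal power series with constant term $1$ whose square is $1-6x+x^2$. Moreover, for all $n\ge0$, $$\ell(\mathcal S_n)=d_n-r_n-d_{n-1}+r_{n-1}\qquad\text{and}\qquad \ell(\mathcal S_n)=\sum_{k=0}^n\left(\!\binom{2k}{n-k}\!\right)\binom{2k}{k}\frac{k}{k+1}.$$ Finally, $$\ell(\mathcal S_n)\sim\frac{(1+\sqrt2)^{2n}}{\sqrt{\sqrt2\,n\pi}}\qquad\text{and}\qquad i(\mathcal S_n)\sim(2-\sqrt2)\,n .$$ In particular, the Hasse index of the Schröder lattices is asymptotically quasi Boolean: there is a constant $c$ with $0\le c\le 1/10$ such that $i(\mathcal S_n)\sim(\tfrac12+c)\,n$ or $i(\mathcal S_n)\sim(\tfrac12-c)\,n$. -/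

import Mathlib

open PowerSeries Filter Asymptotics

namespace SchroderLattice

/-- The steps `U = (1,1)`, `D = (1,-1)` and `H = (2,0)`. -/
inductive Step
  | U
  | D
  | H

namespace Step

instance : Finite Step :=
  Finite.of_injective (fun s : Step => match s with | U => (0 : Fin 3) | D => 1 | H => 2) <| by
    intro s t h
    cases s <;> cases t <;> simp_all

/-- Horizontal extent of a step. -/
def width : Step → ℕ
  | U => 1
  | D => 1
  | H => 2

/-- Vertical extent of a step. -/
def rise : Step → ℤ
  | U => 1
  | D => -1
  | H => 0

end Step

/-- Abscissa of the endpoint of the path that starts at the origin and is coded by a word. -/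
def pathWidth (w : List Step) : ℕ := (w.map Step.width).sum

/-- Ordinate of the endpoint of the path that starts at the origin and is coded by a word. -/
def pathRise (w : List Step) : ℤ := (w.map Step.rise).sum

/-- Ordinate of the path at the integer abscissa `x` (the final ordinate when `x` is beyond the
endpoint). The path is linear between consecutive integer abscissas, so these values determine
its position with respect to the axis and to the other paths. -/
def height : List Step → ℕ → ℤ
  | [], _ => 0
  | _ :: _, 0 => 0
  | Step.U :: w, x + 1 => 1 + height w x
  | Step.D :: w, x + 1 => -1 + height w x
  | Step.H :: _, 1 => 0
  | Step.H :: w, x + 2 => height w x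

/-- Grand Schröder paths of semi-length `n`: they run from `(0,0)` to `(2n,0)`. -/
def IsGrandSchroder (n : ℕ) (w : List Step) : Prop :=
  pathWidth w = 2 * n ∧ pathRise w = 0

/-- Schröder paths of semi-length `n`: Grand Schröder paths that never go below the axis. -/
def IsSchroder (n : ℕ) (w : List Step) : Prop :=
  IsGrandSchroder n w ∧ ∀ x, 0 ≤ height w x

/-- The set of all Schröder paths of semi-length `n`. -/
def SchroderPath (n : ℕ) : Type := {w : List Step // IsSchroder n w}

theorem height_zero (w : List Step) : height w 0 = 0 := by
  cases w with
  | nil => rfl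
  | cons s w => cases s <;> rfl

theorem eq_of_height_eq : ∀ (v w : List Step), pathWidth v = pathWidth w →
    (∀ x, height v x = height w x) → v = w
  | [], [], _, _ => rfl
  | [], s :: w, h, _ => by
      cases s <;> simp [pathWidth, Step.width] at h <;> omega
  | s :: v, [], h, _ => by
      cases s <;> simp [pathWidth, Step.width] at h
  | s :: v, t :: w, h, hx => by
      have h1 := hx 1
      cases s <;> cases t <;>
        simp [height, height_zero] at h1 <;>
        congr 1 <;>
        apply eq_of_height_eq v w
      · simpa [pathWidth, Step.width] using h
      · intro x; simpa [height] using hx (x + 1)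
      · simpa [pathWidth, Step.width] using h
      · intro x; simpa [height] using hx (x + 1)
      · simpa [pathWidth, Step.width] using h
      · intro x; simpa [height] using hx (x + 2)

theorem length_le_pathWidth (w : List Step) : w.length ≤ pathWidth w := by
  induction w with
  | nil => simp
  | cons s w ih => cases s <;> simp [pathWidth, Step.width] at ih ⊢ <;> omega

/-- A path is at most another path when it lies weakly below it. -/
instance (n : ℕ) : PartialOrder (SchroderPath n) where
  le v w := ∀ x, height v.1 x ≤ height w.1 x
  le_refl _ _ := le_rfl
  le_trans _ _ _ h h' x := (h x).trans (h' x)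
  le_antisymm v w h h' := Subtype.ext <|
    eq_of_height_eq v.1 w.1 (v.2.1.1.trans w.2.1.1.symm) fun x => le_antisymm (h x) (h' x)

instance (n : ℕ) : Finite (SchroderPath n) :=
  ((List.finite_length_le Step (2 * n)).subset fun w (hw : IsSchroder n w) =>
    (length_le_pathWidth w).trans hw.1.1.le).to_subtype

/-- The number of edges of the Hasse diagram of a finite poset. -/
noncomputable def edgeCount (P : Type*) [PartialOrder P] : ℕ :=
  Nat.card {p : P × P // p.1 ⋖ p.2}

/-- The Hasse index of a finite poset: edges over vertices in its Hasse diagram. -/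
noncomputable def hasseIndex (P : Type*) [PartialOrder P] : ℝ :=
  (edgeCount P : ℝ) / (Nat.card P : ℝ)

/-- The Hasse index of a sequence of posets is equivalent to `(1/2 ± c) n` with
`0 ≤ c ≤ 1/10`. -/
def IsAsymptoticallyQuasiBoolean (P : ℕ → Type*) [∀ n, PartialOrder (P n)] : Prop :=
  ∃ c : ℝ, 0 ≤ c ∧ c ≤ 1 / 10 ∧
    (((fun n : ℕ => hasseIndex (P n)) ~[atTop] fun n : ℕ => (1 / 2 + c) * (n : ℝ)) ∨
      ((fun n : ℕ => hasseIndex (P n)) ~[atTop] fun n : ℕ => (1 / 2 - c) * (n : ℝ)))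

/-- The edge generating series of a sequence of finite posets. -/
noncomputable def edgeSeries (P : ℕ → Type*) [∀ n, PartialOrder (P n)] : ℚ⟦X⟧ :=
  PowerSeries.mk fun n => (edgeCount (P n) : ℚ)

/-- The central Delannoy numbers `1, 3, 13, 63, …`. -/
def centralDelannoy (n : ℕ) : ℕ :=
  ∑ k ∈ Finset.range (n + 1), n.choose k * (n + k).choose k

/-- The generating series of the central Delannoy numbers. -/
noncomputable def delannoySeries : ℚ⟦X⟧ :=
  PowerSeries.mk fun n => (centralDelannoy n : ℚ)

/-- The generating series of the large Schröder numbers `1, 2, 6, 22, …`. -/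
noncomputable def largeSchroderSeries : ℚ⟦X⟧ :=
  PowerSeries.mk fun n => (Nat.largeSchroder n : ℚ)

end SchroderLattice

/-! A path is covered exactly by the paths obtained from it by turning one factor `H` into `UD` or
one factor `DU` into `H` (`covBy_iff_mem_raises`). Such a move lifts the path by one at a single
abscissa, so nothing fits in between; conversely, below any larger path such a move is always
available (`exists_raise_le`).

Edges are thus factors `H` and `DU` of Schröder words, and the first-return decomposition `H w` or
`U a D b` counts them. With `s = 1 - x - 2xr`, it gives `ℓ s = (1 - x) x r²` (`edgeSeries_mul`). The
quadratic equation of `r` says that `s² = 1 - 6x + x²`.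

Let `C` and `B` be the Catalan and central binomial series and `K = x / (1 - x)²`. Then `r = C(K) /
(1 - x)` and `d = B(K) / (1 - x)`. Substituting `K` in `B (1 - 2xC) = 1` gives `d s = 1`, hence `ℓ =
(1 - x)(d - r) = (B - C)(K)`, from which the multiset formula is read off.

For the asymptotics, `d = 1 / s` is a product of two inverse square roots with reciprocal rates `(1
+ √2)²` and `3 - 2√2`. Stirling's formula and dominated convergence in the convolution give `dₙ`;
differentiating `s²` expresses `rₙ` through `dₙ` and `dₙ₋₁`, with an extra factor of order `1 / n`.
-/

namespace SchroderLattice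

/-! ### Upper covers as local moves on words -/

/-- The words obtained from `w` by replacing one factor `H` by `UD`, or one factor `DU` by `H`. -/
def raises : List Step → List (List Step)
  | [] => []
  | Step.U :: w => (raises w).map (Step.U :: ·)
  | Step.H :: w => (Step.U :: Step.D :: w) :: (raises w).map (Step.H :: ·)
  | Step.D :: Step.U :: w =>
      (Step.H :: w) :: (raises (Step.U :: w)).map (Step.D :: ·)
  | Step.D :: w => (raises w).map (Step.D :: ·)

theorem raises_D_of_ne {w : List Step} (h : ∀ w', w ≠ Step.U :: w') :
    raises (Step.D :: w) = (raises w).map (Step.D :: ·) := by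
  match w with
  | [] => rfl
  | Step.U :: w' => exact absurd rfl (h w')
  | Step.D :: w' => simp [raises]
  | Step.H :: w' => simp [raises]

theorem map_cons_subset_raises {w u : List Step} (s : Step) (hu : u ∈ raises w) :
    s :: u ∈ raises (s :: w) := by
  match s, w with
  | Step.U, w => simpa [raises] using hu
  | Step.H, w => simpa [raises] using hu
  | Step.D, [] => simp [raises] at hu
  | Step.D, Step.U :: w => simp only [raises, List.mem_cons, List.mem_map] at hu ⊢; grind
  | Step.D, Step.D :: w => simpa [raises] using hu
  | Step.D, Step.H :: w => simp only [raises, List.mem_cons, List.mem_map] at hu ⊢; grind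

/-- A move at the front changes the first letter, while a move in the tail keeps it. Hence the
length of the list counts covers. -/
theorem nodup_raises (w : List Step) : (raises w).Nodup := by
  induction w using raises.induct with
  | case1 => simp [raises]
  | case2 w ih => simpa [raises] using ih.map (List.cons_injective)
  | case3 w ih => simpa [raises] using ih.map (List.cons_injective)
  | case4 w ih => simpa [raises] using ih.map (List.cons_injective)
  | case5 w h ih =>
    rw [raises_D_of_ne h]
    exact ih.map List.cons_injective

@[simp] theorem height_nil (x : ℕ) : height [] x = 0 := by cases x <;> rfl
@[simp] theorem height_U_succ (w : List Step) (x : ℕ) :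
    height (Step.U :: w) (x + 1) = 1 + height w x := rfl
@[simp] theorem height_D_succ (w : List Step) (x : ℕ) :
    height (Step.D :: w) (x + 1) = -1 + height w x := rfl
@[simp] theorem height_H_one (w : List Step) : height (Step.H :: w) 1 = 0 := rfl
@[simp] theorem height_H_add_two (w : List Step) (x : ℕ) :
    height (Step.H :: w) (x + 2) = height w x := rfl

attribute [simp] height_zero

@[simp] theorem pathWidth_nil : pathWidth [] = 0 := rfl
@[simp] theorem pathWidth_cons (s : Step) (w : List Step) :
    pathWidth (s :: w) = s.width + pathWidth w := by simp [pathWidth]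
@[simp] theorem pathWidth_append (v w : List Step) :
    pathWidth (v ++ w) = pathWidth v + pathWidth w := by simp [pathWidth]
@[simp] theorem pathRise_nil : pathRise [] = 0 := rfl
@[simp] theorem pathRise_cons (s : Step) (w : List Step) :
    pathRise (s :: w) = s.rise + pathRise w := by simp [pathRise]
@[simp] theorem pathRise_append (v w : List Step) :
    pathRise (v ++ w) = pathRise v + pathRise w := by simp [pathRise]
attribute [simp] Step.width Step.rise

/-- A raise keeps the endpoint and adds one to the height at a single abscissa. -/
theorem spec_of_mem_raises {w u : List Step} (hu : u ∈ raises w) :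
    pathWidth u = pathWidth w ∧ pathRise u = pathRise w ∧
      ∃ x₀, ∀ x, height u x = height w x + if x = x₀ then 1 else 0 := by
  have lift_one (s : Step) (hs : s ≠ Step.H) {w v : List Step}
      (h : pathWidth v = pathWidth w ∧ pathRise v = pathRise w ∧
        ∃ x₀, ∀ x, height v x = height w x + if x = x₀ then 1 else 0) :
      pathWidth (s :: v) = pathWidth (s :: w) ∧ pathRise (s :: v) = pathRise (s :: w) ∧
        ∃ x₀, ∀ x, height (s :: v) x = height (s :: w) x + if x = x₀ then 1 else 0 := by
    obtain ⟨h1, h2, x₀, h3⟩ := h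
    refine ⟨by simp [h1], by simp [h2], x₀ + 1, fun x => ?_⟩
    cases x with
    | zero => simp
    | succ x => cases s <;> simp_all <;> ring
  induction w using raises.induct generalizing u with
  | case1 => simp [raises] at hu
  | case2 w ih =>
    simp only [raises, List.mem_map] at hu
    obtain ⟨v, hv, rfl⟩ := hu
    exact lift_one _ (by simp) (ih hv)
  | case3 w ih =>
    simp only [raises, List.mem_cons, List.mem_map] at hu
    obtain rfl | ⟨v, hv, rfl⟩ := hu
    · refine ⟨by simp; ring, by simp, 1, fun x => ?_⟩
      match x with
      | 0 => simp
      | 1 => simp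
      | x + 2 => simp
    · obtain ⟨h1, h2, x₀, h3⟩ := ih hv
      refine ⟨by simp [h1], by simp [h2], x₀ + 2, fun x => ?_⟩
      match x with
      | 0 => simp
      | 1 => simp
      | x + 2 => simp [h3]
  | case4 w ih =>
    simp only [raises, List.mem_cons] at hu
    obtain rfl | hu := hu
    · refine ⟨by simp; ring, by simp, 1, fun x => ?_⟩
      match x with
      | 0 => simp
      | 1 => simp
      | x + 2 => simp
    · rw [List.mem_map] at hu
      obtain ⟨v, hv, rfl⟩ := hu
      exact lift_one _ (by simp) (ih (by simpa [raises] using hv))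
  | case5 w h ih =>
    rw [raises_D_of_ne h, List.mem_map] at hu
    obtain ⟨v, hv, rfl⟩ := hu
    exact lift_one _ (by simp) (ih hv)

theorem height_of_pathWidth_le {w : List Step} {x : ℕ} (h : pathWidth w ≤ x) :
    height w x = pathRise w := by
  induction w generalizing x with
  | nil => simp
  | cons s w ih =>
    match s, x with
    | Step.U, x + 1 => simp at h ⊢; exact ih (by omega)
    | Step.D, x + 1 => simp at h ⊢; exact ih (by omega)
    | Step.H, x + 2 => simp at h ⊢; exact ih (by omega)
    | Step.U, 0 => simp at h
    | Step.D, 0 => simp at h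
    | Step.H, 0 => simp at h
    | Step.H, 1 => simp at h; omega

theorem height_sub_one_le (w : List Step) (x : ℕ) : height w x - 1 ≤ height w (x + 1) := by
  induction w generalizing x with
  | nil => simp
  | cons s w ih =>
    match s, x with
    | Step.U, 0 => simp
    | Step.D, 0 => simp
    | Step.H, 0 => simp
    | Step.H, 1 => simp
    | Step.U, x + 1 => have := ih x; simp; omega
    | Step.D, x + 1 => have := ih x; simp; omega
    | Step.H, x + 2 => have := ih x; simp; omega

/-- The points of a path whose coordinates have an odd sum are midpoints of horizontal steps. -/
theorem height_succ_of_odd (w : List Step) (x : ℕ) (h : Odd ((x : ℤ) + 1 + height w (x + 1)))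
    : height w (x + 1) = height w x := by
  induction w generalizing x with
  | nil => simp
  | cons s w ih =>
    match s, x with
    | Step.U, 0 => simp at h; exact absurd h (by decide)
    | Step.D, 0 => simp at h
    | Step.H, 0 => simp
    | Step.H, 1 => simp
    | Step.U, x + 1 =>
      obtain ⟨k, hk⟩ := h
      simp only [height_U_succ] at hk ⊢
      rw [ih x ⟨k - 1, by push_cast at hk; linarith⟩]
    | Step.D, x + 1 =>
      obtain ⟨k, hk⟩ := h
      simp only [height_D_succ] at hk ⊢
      rw [ih x ⟨k, by push_cast at hk; linarith⟩]
    | Step.H, x + 2 =>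
      obtain ⟨k, hk⟩ := h
      change height w (x + 1) = height w x
      change ((x + 2 : ℕ) : ℤ) + 1 + height w (x + 1) = _ at hk
      exact ih x ⟨k - 1, by push_cast at hk; linarith⟩

/-- A descent that lies strictly below `f` contains a raise that stays weakly below `f`. -/
theorem exists_raise_of_descent (v : List Step) (f : ℕ → ℤ) (hf0 : 1 ≤ f 0)
    (hvf : ∀ x, height v x ≤ f x) (hend : f (pathWidth v) = pathRise v)
    (hstep : ∀ x, f x - 1 ≤ f (x + 1))
    (hodd : ∀ x : ℕ, Odd ((x : ℤ) + 1 + f (x + 1)) → f (x + 1) = f x) :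
    ∃ u ∈ raises (Step.D :: v), ∀ x, height u (x + 1) + 1 ≤ f x := by
  induction v generalizing f with
  | nil => simp at hend; omega
  | cons s v ih =>
    cases s with
    | U =>
      refine ⟨Step.H :: v, by simp [raises], fun x => ?_⟩
      cases x with
      | zero => simpa using hf0
      | succ x => have := hvf (x + 1); simp at this ⊢; omega
    | D =>
      -- The origin moves by `(1, -1)` along the extra `D`, which shifts the bound to `f (x + 1) +
      -- 1`; the parity of abscissa plus ordinate is unchanged.
      obtain ⟨u, hu, h⟩ := ih (fun x => f (x + 1) + 1) (by have := hstep 0; simp at this ⊢; omega)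
        (fun x => by have := hvf (x + 1); simp at this ⊢; omega)
        (by simp [add_comm 1] at hend ⊢; omega)
        (fun x => by have := hstep (x + 1); simp; omega)
        (fun x hx => by
          have := hodd (x + 1) (by push_cast; convert hx using 1; ring)
          simpa using this)
      refine ⟨Step.D :: u, map_cons_subset_raises _ hu, fun x => ?_⟩
      cases x with
      | zero => simpa using by omega
      | succ x => have := h x; simp; omega
    | H =>
      refine ⟨Step.D :: Step.U :: Step.D :: v, by simp [raises], fun x => ?_⟩
      match x with
      | 0 => simp; omega
      -- The new peak needs `1 ≤ f 1`. The step bound gives `0 ≤ f 1`, and `f 1 = 0` has the parity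
      -- of a midpoint of a horizontal step, which would force `f 1 = f 0 ≥ 1`.
      | 1 =>
        have h1 := hstep 0
        have h2 := hodd 0
        by_contra h
        simp at h h1 h2
        have h0 : f 1 = 0 := by omega
        rw [h0] at h2
        have := h2 (by decide)
        omega
      | x + 2 => have := hvf (x + 2); simp at this ⊢; omega

/-- Between two distinct comparable paths with the same endpoint there is a raise of the
lower one. -/
theorem exists_raise_le (v w : List Step) (hW : pathWidth v = pathWidth w)
    (hR : pathRise v = pathRise w) (h : ∀ x, height v x ≤ height w x) :
    v = w ∨ ∃ u ∈ raises v, ∀ x, height u x ≤ height w x := by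
  induction v generalizing w with
  | nil =>
    cases w with
    | nil => exact .inl rfl
    | cons s w => cases s <;> simp at hW <;> omega
  | cons s v ih =>
    cases w with
    | nil => cases s <;> simp at hW
    | cons t w =>
      have hdesc (ht : t ≠ Step.D) (hs : s = Step.D) :
          ∃ u ∈ raises (s :: v), ∀ x, height u x ≤ height (t :: w) x := by
        subst hs
        -- The origin is moved to the end of the leading `D`; seen from there, the upper path has
        -- height `height (t :: w) (x + 1) + 1`.
        obtain ⟨u, hu, hx⟩ := exists_raise_of_descent v (fun x => height (t :: w) (x + 1) + 1)
          (by cases t <;> simp at ht ⊢)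
          (fun x => by have := h (x + 1); simp at this; omega)
          (by
            have := height_of_pathWidth_le (w := t :: w) (x := pathWidth v + 1)
              (by rw [← hW]; simp; omega)
            simp only [this, ← hR]; simp)
          (fun x => by have := height_sub_one_le (t :: w) (x + 1); simp; omega)
          (fun x hx => by
            have := height_succ_of_odd (t :: w) (x + 1)
              (by push_cast; convert hx using 1; ring)
            simpa using this)
        refine ⟨u, hu, fun x => ?_⟩
        cases x with
        | zero => simp
        | succ x => have := hx x; omega
      have hsame (hst : s = t) (hv : ∀ x, height v x ≤ height w x) : s :: v = t :: w ∨
          ∃ u ∈ raises (s :: v), ∀ x, height u x ≤ height (t :: w) x := by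
        subst hst
        obtain rfl | ⟨u, hu, hx⟩ := ih w (by simpa using hW) (by simpa using hR) hv
        · exact .inl rfl
        · refine .inr ⟨s :: u, map_cons_subset_raises s hu, fun x => ?_⟩
          match s, x with
          | _, 0 => simp
          | Step.U, x + 1 => simpa using hx x
          | Step.D, x + 1 => simpa using hx x
          | Step.H, 1 => simp
          | Step.H, x + 2 => simpa using hx x
      have h1 := h 1
      match s, t with
      | Step.U, Step.U => exact hsame rfl fun x => by simpa using h (x + 1)
      | Step.D, Step.D => exact hsame rfl fun x => by simpa using h (x + 1)
      | Step.H, Step.H => exact hsame rfl fun x => by simpa using h (x + 2)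
      | Step.D, Step.U => exact .inr (hdesc (by simp) rfl)
      | Step.D, Step.H => exact .inr (hdesc (by simp) rfl)
      | Step.U, Step.D => simp [height] at h1
      | Step.U, Step.H => simp [height] at h1
      | Step.H, Step.D => simp [height] at h1
      | Step.H, Step.U =>
        refine .inr ⟨Step.U :: Step.D :: v, by simp [raises], fun x => ?_⟩
        match x with
        | 0 => simp
        | 1 => simp
        | x + 2 => simpa using h (x + 2)

theorem isSchroder_of_mem_raises {n : ℕ} {w u : List Step} (hw : IsSchroder n w)
    (hu : u ∈ raises w) : IsSchroder n u := by
  obtain ⟨h1, h2, x₀, h3⟩ := spec_of_mem_raises hu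
  refine ⟨⟨h1.trans hw.1.1, h2.trans hw.1.2⟩, fun x => ?_⟩
  have := hw.2 x
  rw [h3]
  split_ifs <;> omega

/-- The upper covers of a Schröder path are its raises. -/
theorem covBy_iff_mem_raises {n : ℕ} (v w : SchroderPath n) : v ⋖ w ↔ w.1 ∈ raises v.1 := by
  constructor
  · intro hc
    obtain h | ⟨u, hu, hx⟩ := exists_raise_le v.1 w.1 (v.2.1.1.trans w.2.1.1.symm)
      (v.2.1.2.trans w.2.1.2.symm) hc.le
    · exact absurd (Subtype.ext h) hc.ne
    · obtain ⟨-, -, x₀, h3⟩ := spec_of_mem_raises hu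
      let u' : SchroderPath n := ⟨u, isSchroder_of_mem_raises v.2 hu⟩
      have hvu : v ≤ u' := fun x => by
        show height v.1 x ≤ height u x
        rw [h3]; split_ifs <;> omega
      have hne : v ≠ u' := fun h => by
        have := h3 x₀
        rw [show u = v.1 from congrArg Subtype.val h.symm] at this
        simp at this
      have huw : u' ≤ w := hx
      obtain h | h := hc.eq_or_eq hvu huw
      · exact absurd h.symm hne
      · rwa [← h]
  · intro hu
    obtain ⟨-, -, x₀, h3⟩ := spec_of_mem_raises hu
    refine ⟨lt_of_le_of_ne (fun x => ?_) fun h => ?_, fun u hvu huw => ?_⟩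
    · rw [h3]; split_ifs <;> omega
    · have := h3 x₀
      rw [h] at this
      simp at this
    · have h1 : ∀ x, height v.1 x ≤ height u.1 x := hvu.le
      have h2 : ∀ x, height u.1 x ≤ height w.1 x := huw.le
      -- The two outer paths differ only at `x₀`, and there by one, so the height at `x₀` decides
      -- which of them the middle path equals.
      by_cases hx : height u.1 x₀ = height v.1 x₀
      · refine hvu.not_ge fun x => ?_
        have := h2 x
        rw [h3] at this
        split_ifs at this with h
        · rw [h, hx]
        · omega
      · refine huw.not_ge fun x => ?_
        have := h1 x₀
        have := h1 x
        rw [h3]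
        split_ifs with h
        · subst h; omega
        · omega

/-- The Schröder words of semi-length `n`. -/
noncomputable def words (n : ℕ) : Finset (List Step) :=
  (((List.finite_length_le Step (2 * n)).subset fun w (hw : IsSchroder n w) =>
    (length_le_pathWidth w).trans hw.1.1.le)).toFinset

@[simp] theorem mem_words {n : ℕ} {w : List Step} : w ∈ words n ↔ IsSchroder n w := by
  exact Set.Finite.mem_toFinset _

noncomputable instance (n : ℕ) : Fintype (SchroderPath n) := Fintype.ofFinite _

theorem sum_schroderPath {M : Type*} [AddCommMonoid M] (n : ℕ) (f : List Step → M) :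
    ∑ v : SchroderPath n, f v.1 = ∑ w ∈ words n, f w :=
  Finset.sum_bij (fun v _ => v.1) (fun v _ => mem_words.2 v.2) (fun _ _ _ _ h => Subtype.ext h)
    (fun w hw => ⟨⟨w, mem_words.1 hw⟩, Finset.mem_univ _, rfl⟩) fun _ _ => rfl

theorem card_schroderPath (n : ℕ) : Nat.card (SchroderPath n) = (words n).card := by
  rw [Nat.card_eq_fintype_card, Fintype.card, Finset.card_eq_sum_ones,
    sum_schroderPath n fun _ => 1, Finset.card_eq_sum_ones]

theorem edgeCount_eq_sum_raises (n : ℕ) :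
    edgeCount (SchroderPath n) = ∑ w ∈ words n, (raises w).length := by
  classical
  have e : {p : SchroderPath n × SchroderPath n // p.1 ⋖ p.2} ≃
      Σ v : SchroderPath n, {w : SchroderPath n // v ⋖ w} :=
    { toFun := fun p => ⟨p.1.1, p.1.2, p.2⟩
      invFun := fun q => ⟨(q.1, q.2.1), q.2.2⟩
      left_inv := fun _ => rfl
      right_inv := fun _ => rfl }
  rw [edgeCount, Nat.card_congr e, Nat.card_sigma, ← sum_schroderPath]
  refine Finset.sum_congr rfl fun v _ => ?_
  have e' : {w : SchroderPath n // v ⋖ w} ≃ {u // u ∈ (raises v.1).toFinset} :=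
    { toFun := fun w => ⟨w.1.1, List.mem_toFinset.2 ((covBy_iff_mem_raises _ _).1 w.2)⟩
      invFun := fun u => ⟨⟨u.1, isSchroder_of_mem_raises v.2 (List.mem_toFinset.1 u.2)⟩,
        (covBy_iff_mem_raises _ _).2 (List.mem_toFinset.1 u.2)⟩
      left_inv := fun _ => rfl
      right_inv := fun _ => rfl }
  rw [Nat.card_congr e', Nat.card_eq_fintype_card, Fintype.card_coe,
    List.toFinset_card_of_nodup (nodup_raises _)]

end SchroderLattice

/-! ### First-return decomposition of Schröder words -/

namespace SchroderLattice

/-- The path coded by a word, started at ordinate `k`, never goes below the axis. -/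
def StaysNonneg : ℤ → List Step → Prop
  | k, [] => 0 ≤ k
  | k, s :: w => 0 ≤ k ∧ StaysNonneg (k + s.rise) w

theorem StaysNonneg.nonneg {k : ℤ} {w : List Step} (h : StaysNonneg k w) : 0 ≤ k := by
  cases w with
  | nil => exact h
  | cons s w => exact h.1

/-- Testing the ends of steps suffices, because the midpoint of `H` has the ordinate of its ends. -/
theorem staysNonneg_iff (k : ℤ) (w : List Step) :
    StaysNonneg k w ↔ ∀ x, 0 ≤ k + height w x := by
  induction w generalizing k with
  | nil => simp [StaysNonneg]
  | cons s w ih =>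
    rw [StaysNonneg, ih]
    constructor
    · rintro ⟨h0, h⟩ x
      match s, x with
      | _, 0 => simpa using h0
      | Step.U, x + 1 => have := h x; simp at this ⊢; omega
      | Step.D, x + 1 => have := h x; simp at this ⊢; omega
      | Step.H, 1 => simpa using h0
      | Step.H, x + 2 => have := h x; simp at this ⊢; omega
    · intro h
      refine ⟨by simpa using h 0, fun x => ?_⟩
      match s with
      | Step.U => have := h (x + 1); simp at this ⊢; omega
      | Step.D => have := h (x + 1); simp at this ⊢; omega
      | Step.H => have := h (x + 2); simp at this ⊢; omega

theorem staysNonneg_append (k : ℤ) (v w : List Step) :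
    StaysNonneg k (v ++ w) ↔ StaysNonneg k v ∧ StaysNonneg (k + pathRise v) w := by
  induction v generalizing k with
  | nil => simpa [StaysNonneg] using StaysNonneg.nonneg
  | cons s v ih => simp [StaysNonneg, ih, and_assoc, add_assoc]

theorem StaysNonneg.mono {k l : ℤ} (hkl : k ≤ l) {w : List Step} (h : StaysNonneg k w) :
    StaysNonneg l w := by
  rw [staysNonneg_iff] at *
  intro x
  linarith [h x]

theorem isSchroder_iff {n : ℕ} {w : List Step} :
    IsSchroder n w ↔ pathWidth w = 2 * n ∧ pathRise w = 0 ∧ StaysNonneg 0 w := by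
  simp [IsSchroder, IsGrandSchroder, staysNonneg_iff, and_assoc]

theorem isSchroder_H_cons {n : ℕ} {w : List Step} :
    IsSchroder (n + 1) (Step.H :: w) ↔ IsSchroder n w := by
  simp only [isSchroder_iff, pathWidth_cons, pathRise_cons, StaysNonneg, Step.width, Step.rise]
  simp only [le_refl, true_and, zero_add, add_zero]
  refine and_congr_left fun _ => ?_
  omega

/-- Ensures that a factor returning to its initial ordinate has an integral semi-length. -/
theorem even_pathWidth_add_pathRise (w : List Step) : Even ((pathWidth w : ℤ) + pathRise w) := by
  induction w with
  | nil => simp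
  | cons s w ih =>
    obtain ⟨k, hk⟩ := ih
    cases s
    · exact ⟨k + 1, by simp; linarith⟩
    · exact ⟨k, by simp; linarith⟩
    · exact ⟨k + 1, by simp; linarith⟩

theorem IsSchroder.elevate {i j : ℕ} {a b : List Step} (ha : IsSchroder i a)
    (hb : IsSchroder j b) : IsSchroder (i + j + 1) (Step.U :: (a ++ Step.D :: b)) := by
  rw [isSchroder_iff] at *
  obtain ⟨a1, a2, a3⟩ := ha
  obtain ⟨b1, b2, b3⟩ := hb
  refine ⟨by simp [a1, b1]; ring, by simp [a2, b2], ?_⟩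
  simp only [StaysNonneg, staysNonneg_append, a2, Step.rise]
  exact ⟨le_rfl, a3.mono (by simp), by simp, by simpa using b3⟩

/-- A path that ends below the axis decomposes at its first step below the axis. -/
theorem exists_first_passage (k : ℤ) (w : List Step) (hk : 0 ≤ k) (hw : k + pathRise w < 0) :
    ∃ a b, w = a ++ Step.D :: b ∧ k + pathRise a = 0 ∧ StaysNonneg k a := by
  induction w generalizing k with
  | nil => simp at hw; omega
  | cons s w ih =>
    by_cases h0 : 0 ≤ k + s.rise
    · obtain ⟨a, b, rfl, h1, h2⟩ := ih (k + s.rise) h0 (by rw [pathRise_cons] at hw; omega)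
      exact ⟨s :: a, b, by simp, by rw [pathRise_cons]; omega, hk, h2⟩
    · cases s with
      | U => simp at h0; omega
      | H => simp at h0; omega
      | D => exact ⟨[], w, by simp, by simp at h0 ⊢; omega, hk⟩

theorem IsSchroder.exists_elevate {n : ℕ} {w : List Step}
    (hw : IsSchroder (n + 1) (Step.U :: w)) :
    ∃ i j a b, i + j = n ∧ IsSchroder i a ∧ IsSchroder j b ∧ w = a ++ Step.D :: b := by
  rw [isSchroder_iff] at hw
  obtain ⟨h1, h2, h3⟩ := hw
  -- Without its first `U`, the word started at 0 ends at -1; its first step below 0 is the first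
  -- return of the original path to the axis.
  obtain ⟨a, b, rfl, ha, ha'⟩ := exists_first_passage 0 w le_rfl (by simp at h2 ⊢; omega)
  rw [zero_add] at ha
  obtain ⟨k, hk⟩ := even_pathWidth_add_pathRise a
  simp [ha] at h1 h2
  have hk' : k = (k.toNat : ℤ) := by omega
  refine ⟨k.toNat, n - k.toNat, a, b, by omega, ?_, ?_, rfl⟩
  · rw [isSchroder_iff]
    exact ⟨by omega, ha, ha'⟩
  · rw [isSchroder_iff]
    refine ⟨by omega, h2, ?_⟩
    simp only [StaysNonneg, staysNonneg_append, ha] at h3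
    simpa using h3.2.2.2

/-- If `a` were a proper prefix of `a'`, the `D` that follows `a` would be a step of `a'` leading
below the axis. -/
theorem append_D_cons_inj {a a' b b' : List Step} (ha : StaysNonneg 0 a) (ha' : StaysNonneg 0 a')
    (h0 : pathRise a = 0) (h0' : pathRise a' = 0) (h : a ++ Step.D :: b = a' ++ Step.D :: b') :
    a = a' ∧ b = b' := by
  have key {a a' b b' c : List Step} (ha' : StaysNonneg 0 a') (h0 : pathRise a = 0)
      (hc : a' = a ++ c) (hb : Step.D :: b = c ++ Step.D :: b') : a = a' ∧ b = b' := by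
    cases c with
    | nil => simp_all
    | cons s c =>
      simp only [List.cons_append, List.cons.injEq] at hb
      rw [hc, staysNonneg_append, h0, ← hb.1] at ha'
      simpa using ha'.2.2.nonneg
  obtain ⟨c, hc, hb⟩ | ⟨c, hc, hb⟩ := List.append_eq_append_iff.1 h
  · exact key ha' h0 hc hb
  · exact (key ha h0' hc hb).imp Eq.symm Eq.symm

theorem words_zero : words 0 = {[]} := by
  ext w
  rw [mem_words, Finset.mem_singleton]
  constructor
  · intro h
    have := length_le_pathWidth w
    rw [h.1.1] at this
    simpa using this
  · rintro rfl
    rw [isSchroder_iff]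
    simp [StaysNonneg]

/-- First-return decomposition of a sum over Schröder words. -/
theorem sum_words_succ {M : Type*} [AddCommMonoid M] (n : ℕ) (f : List Step → M) :
    ∑ w ∈ words (n + 1), f w = ∑ w ∈ words n, f (Step.H :: w) +
      ∑ p ∈ Finset.HasAntidiagonal.antidiagonal n, ∑ a ∈ words p.1, ∑ b ∈ words p.2, f (Step.U :: (a ++ Step.D :: b)) := by
  classical
  rw [← Finset.sum_filter_add_sum_filter_not _ fun w => w.head? = some Step.H]
  congr 1
  · symm
    refine Finset.sum_bij (fun w _ => Step.H :: w) (fun w hw => ?_) (fun _ _ _ _ h => by simpa using h)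
      (fun w hw => ?_) fun _ _ => rfl
    · simpa [isSchroder_H_cons] using hw
    · rw [Finset.mem_filter, mem_words, List.head?_eq_some_iff] at hw
      obtain ⟨hw, v, rfl⟩ := hw
      exact ⟨v, mem_words.2 (isSchroder_H_cons.1 hw), rfl⟩
  · simp_rw [← Finset.sum_product', Finset.sum_sigma']
    symm
    refine Finset.sum_bij (fun q _ => Step.U :: (q.2.1 ++ Step.D :: q.2.2)) (fun q hq => ?_) ?_
      (fun w hw => ?_) fun _ _ => rfl
    · simp only [Finset.mem_sigma, Finset.HasAntidiagonal.mem_antidiagonal, Finset.mem_product, mem_words] at hq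
      simp only [Finset.mem_filter, mem_words]
      refine ⟨?_, by simp⟩
      rw [← hq.1]
      exact hq.2.1.elevate hq.2.2
    · rintro ⟨⟨i, j⟩, a, b⟩ hq ⟨⟨i', j'⟩, a', b'⟩ hq' h
      simp only [Finset.mem_sigma, Finset.HasAntidiagonal.mem_antidiagonal, Finset.mem_product, mem_words,
        isSchroder_iff] at hq hq'
      obtain ⟨rfl, rfl⟩ := append_D_cons_inj hq.2.1.2.2 hq'.2.1.2.2 hq.2.1.2.1 hq'.2.1.2.1
        (List.cons_injective h)
      have h1 : i = i' := by have := hq.2.1.1; have := hq'.2.1.1; omega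
      have h2 : j = j' := by have := hq.2.2.1; have := hq'.2.2.1; omega
      rw [h1, h2]
    · rw [Finset.mem_filter, mem_words] at hw
      obtain ⟨hw, hh⟩ := hw
      match w with
      | [] => simp [IsSchroder, IsGrandSchroder] at hw
      | Step.H :: w => simp at hh
      | Step.D :: w =>
        rw [isSchroder_iff] at hw
        simpa using hw.2.2.2.nonneg
      | Step.U :: w =>
        obtain ⟨i, j, a, b, hij, ha, hb, rfl⟩ := hw.exists_elevate
        exact ⟨⟨(i, j), a, b⟩, by simp [hij, ha, hb], rfl⟩

theorem card_words (n : ℕ) : (words n).card = Nat.largeSchroder n := by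
  induction n using Nat.strong_induction_on with
  | _ n ih =>
    cases n with
    | zero => simp [words_zero]
    | succ n =>
      rw [Finset.card_eq_sum_ones, sum_words_succ, Nat.largeSchroder_succ, ← Finset.card_eq_sum_ones,
        ih n (by omega), ← Finset.Iio_add_one_eq_Iic, Nat.Iio_eq_range]
      rw [Finset.Nat.sum_antidiagonal_eq_sum_range_succ_mk]
      congr 1
      refine Finset.sum_congr rfl fun i hi => ?_
      rw [Finset.mem_range] at hi
      simp [ih i (by omega), ih (n - i) (by omega)]

/-! ### Functional equations of the generating series -/

/-- The number of upper covers of the path coded by a word. -/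
def raiseCount (w : List Step) : ℕ := (raises w).length

/-- The indicator of the words that begin with an up step. -/
def upIndicator : List Step → ℕ
  | Step.U :: _ => 1
  | _ => 0

theorem raiseCount_H (w : List Step) : raiseCount (Step.H :: w) = raiseCount w + 1 := by
  simp [raiseCount, raises]

theorem raiseCount_U (w : List Step) : raiseCount (Step.U :: w) = raiseCount w := by
  simp [raiseCount, raises]

theorem raiseCount_D (w : List Step) :
    raiseCount (Step.D :: w) = raiseCount w + upIndicator w := by
  match w with
  | [] => rfl
  | Step.U :: w => simp [raiseCount, raises, upIndicator]
  | Step.D :: w => simp [raiseCount, raises, upIndicator]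
  | Step.H :: w => simp [raiseCount, raises, upIndicator]

/-- No factor `DU` straddles the junction of `a` and `D`; one straddles the junction of `D` and `b`
exactly when `b` begins with `U`. -/
theorem raiseCount_append_D (a b : List Step) :
    raiseCount (a ++ Step.D :: b) = raiseCount a + (raiseCount b + upIndicator b) := by
  induction a with
  | nil => 
    rw [List.nil_append, raiseCount_D]
    simp [raiseCount, raises]
  | cons s a ih =>
    cases s
    · simp [raiseCount_U, ih]
    · have : upIndicator (a ++ Step.D :: b) = upIndicator a := by
        match a with
        | [] => rfl
        | Step.U :: _ => rfl
        | Step.D :: _ => rfl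
        | Step.H :: _ => rfl
      simp only [List.cons_append, raiseCount_D, ih, this]
      ring
    · simp only [List.cons_append, raiseCount_H, ih]
      ring

/-- The generating series of a statistic on Schröder words. -/
noncomputable def wordSeries (f : List Step → ℕ) : ℚ⟦X⟧ :=
  PowerSeries.mk fun n => ((∑ w ∈ words n, f w : ℕ) : ℚ)

theorem largeSchroderSeries_eq_wordSeries : largeSchroderSeries = wordSeries fun _ => 1 := by
  ext n
  simp [largeSchroderSeries, wordSeries, card_words]

theorem edgeSeries_eq_wordSeries : edgeSeries SchroderPath = wordSeries raiseCount := by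
  ext n
  simp [edgeSeries, wordSeries, edgeCount_eq_sum_raises, raiseCount]

/-- The first-return decomposition as an identity of series, with `T` collecting the pairs `(a, b)`.
The functional equations below are instances of it. -/
theorem wordSeries_eq {f h : List Step → ℕ} {c : ℕ} {u : List Step → List Step → ℕ}
    (T : ℚ⟦X⟧) (h0 : f [] = c) (hH : ∀ w, f (Step.H :: w) = h w)
    (hU : ∀ a b, f (Step.U :: (a ++ Step.D :: b)) = u a b)
    (hT : ∀ n, coeff n T = ∑ p ∈ Finset.HasAntidiagonal.antidiagonal n, ∑ a ∈ words p.1, ∑ b ∈ words p.2, (u a b : ℚ)) :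
    wordSeries f = (c : ℚ⟦X⟧) + X * wordSeries h + X * T := by
  ext n
  cases n with
  | zero => simp [wordSeries, words_zero, h0]
  | succ n =>
    rw [map_add, map_add, coeff_succ_X_mul, coeff_succ_X_mul, hT]
    simp only [wordSeries, coeff_mk, sum_words_succ, hH, hU]
    have : coeff (n + 1) (c : ℚ⟦X⟧) = 0 := by
      rw [← map_natCast (C (R := ℚ)), coeff_C]; simp
    rw [this]
    push_cast
    ring

theorem coeff_wordSeries_mul (f g : List Step → ℕ) (n : ℕ) :
    coeff n (wordSeries f * wordSeries g) =
      ∑ p ∈ Finset.HasAntidiagonal.antidiagonal n, ∑ a ∈ words p.1, ∑ b ∈ words p.2, ((f a * g b : ℕ) : ℚ) := by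
  rw [coeff_mul]
  refine Finset.sum_congr rfl fun p _ => ?_
  simp [wordSeries, Finset.sum_mul_sum]

theorem wordSeries_add_one (f : List Step → ℕ) :
    wordSeries (fun w => f w + 1) = wordSeries f + wordSeries fun _ => 1 := by
  ext n
  simp [wordSeries, Finset.sum_add_distrib]

local notation "r" => largeSchroderSeries

theorem largeSchroderSeries_eq : r = 1 + X * r + X * r ^ 2 := by
  rw [largeSchroderSeries_eq_wordSeries]
  convert wordSeries_eq (f := fun _ => 1) (c := 1) (h := fun _ => 1) (u := fun _ _ => 1) rfl (fun _ => rfl)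
    (fun _ _ => rfl) (T := wordSeries (fun _ => 1) ^ 2) ?_ using 1
  · simp
  · intro n
    rw [sq, coeff_wordSeries_mul]

theorem wordSeries_upIndicator : wordSeries upIndicator = X * r ^ 2 := by
  rw [largeSchroderSeries_eq_wordSeries]
  convert wordSeries_eq (f := upIndicator) (h := fun _ => 0) (c := 0)
    (u := fun _ _ => 1) rfl (fun _ => rfl)
    (fun _ _ => rfl) (T := wordSeries (fun _ => 1) ^ 2) ?_ using 1
  · have : wordSeries (fun _ => 0) = 0 := by ext; simp [wordSeries]
    simp [this]
  · intro n
    rw [sq, coeff_wordSeries_mul]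

/-- The decomposition reads `ℓ = x(ℓ + r) + x(2rℓ + r · x r²)`, where the first `r` counts the
leading `H` and `x r²` the junctions `DU`. Then `1 + x r² = (1 - x) r` simplifies the right side. -/
theorem edgeSeries_mul : edgeSeries SchroderPath * (1 - X - 2 * X * r) = (1 - X) * X * r ^ 2 := by
  have h := wordSeries_eq (f := raiseCount) (h := fun w => raiseCount w + 1) (c := 0)
    (u := fun a b => raiseCount a * 1 + 1 * raiseCount b + 1 * upIndicator b)
    (T := wordSeries raiseCount * wordSeries (fun _ => 1)
      + wordSeries (fun _ => 1) * wordSeries raiseCount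
      + wordSeries (fun _ => 1) * wordSeries upIndicator) rfl raiseCount_H
    (fun a b => by rw [raiseCount_U, raiseCount_append_D]; ring)
    (fun n => by
      rw [map_add, map_add]
      simp only [coeff_wordSeries_mul, ← Finset.sum_add_distrib]
      push_cast
      rfl)
  rw [wordSeries_add_one, wordSeries_upIndicator, ← largeSchroderSeries_eq_wordSeries,
    ← edgeSeries_eq_wordSeries] at h
  have hr := largeSchroderSeries_eq
  push_cast at h
  linear_combination h - X * r * hr
end SchroderLattice

/-! ### Substitution of `x / (1 - x)²` in the Catalan and central binomial series -/

namespace SchroderLattice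

/-- The series `1 / (1 - x)`. -/
noncomputable def geomSeries : ℚ⟦X⟧ := PowerSeries.mk 1

/-- The series `x / (1 - x)²`. -/
noncomputable def koebeSeries : ℚ⟦X⟧ := X * geomSeries ^ 2

theorem geomSeries_mul : geomSeries * (1 - X) = 1 := mk_one_mul_one_sub_eq_one ℚ

theorem hasSubst_koebeSeries : HasSubst koebeSeries :=
  HasSubst.of_constantCoeff_zero' (by simp [koebeSeries])

theorem coeff_geomSeries_pow (d n : ℕ) : coeff n (geomSeries ^ d) = (Nat.multichoose d n : ℚ) := by
  cases d with
  | zero => cases n <;> simp [coeff_one]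
  | succ d =>
    rw [geomSeries, mk_one_pow_eq_mk_choose_add, coeff_mk, Nat.multichoose_eq,
      show d + 1 + n - 1 = d + n by omega, Nat.choose_symm_add]

/-- The product is `x ^ k / (1 - x) ^ (e + 2k)`. The case `e = 1` serves the Delannoy numbers, `e =
0` the edge numbers. -/
theorem coeff_geomSeries_pow_mul_koebeSeries_pow (e k n : ℕ) (h : k ≤ n) :
    coeff n (geomSeries ^ e * koebeSeries ^ k) = (Nat.multichoose (e + 2 * k) (n - k) : ℚ) := by
  rw [koebeSeries, mul_pow, mul_left_comm, ← pow_mul, ← pow_add, coeff_X_pow_mul', if_pos h,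
    coeff_geomSeries_pow]

theorem coeff_koebeSeries_pow_of_lt (k n : ℕ) (h : n < k) : coeff n (koebeSeries ^ k) = 0 := by
  rw [koebeSeries, mul_pow, coeff_X_pow_mul', if_neg (by omega)]

/-- `koebeSeries ^ k` has order `k`. The free bound `N` lets all coefficients entering a product
share one range. -/
theorem coeff_subst_koebeSeries (f : ℚ⟦X⟧) {n N : ℕ} (h : n ≤ N) :
    coeff n (f.subst koebeSeries) =
      ∑ k ∈ Finset.range (N + 1), coeff k f * coeff n (koebeSeries ^ k) := by
  rw [coeff_subst' hasSubst_koebeSeries]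
  refine finsum_eq_sum_of_support_subset _ fun k hk => ?_
  by_contra hk'
  simp only [Finset.coe_range, Set.mem_Iio, not_lt] at hk'
  exact hk (by simp [coeff_koebeSeries_pow_of_lt k n (by omega)])

theorem coeff_geomSeries_mul_subst_koebeSeries (f : ℚ⟦X⟧) (n : ℕ) :
    coeff n (geomSeries * f.subst koebeSeries) =
      ∑ k ∈ Finset.range (n + 1), coeff k f * coeff n (geomSeries * koebeSeries ^ k) := by
  simp only [coeff_mul, Finset.mul_sum]
  rw [Finset.sum_comm]
  refine Finset.sum_congr rfl fun p hp => ?_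
  rw [coeff_subst_koebeSeries f (N := n)
    (by have := Finset.HasAntidiagonal.mem_antidiagonal.1 hp; omega), Finset.mul_sum]
  exact Finset.sum_congr rfl fun k _ => by ring

/-- The generating series of the Catalan numbers, over `ℚ`. -/
noncomputable def ratCatalanSeries : ℚ⟦X⟧ := PowerSeries.mk fun n => (catalan n : ℚ)

/-- The generating series of the central binomial coefficients, over `ℚ`. -/
noncomputable def centralBinomSeries : ℚ⟦X⟧ := PowerSeries.mk fun n => (Nat.centralBinom n : ℚ)

theorem ratCatalanSeries_eq : ratCatalanSeries = 1 + X * ratCatalanSeries ^ 2 := by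
  have h : ratCatalanSeries = catalanSeries.map (Nat.castRingHom ℚ) := by
    ext n; simp [ratCatalanSeries]
  conv_lhs => rw [h, ← catalanSeries_sq_mul_X_add_one]
  simp [h]
  ring

theorem derivative_X_mul_ratCatalanSeries :
    derivative ℚ (X * ratCatalanSeries) = centralBinomSeries := by
  ext n
  rw [coeff_derivative, coeff_succ_X_mul, ratCatalanSeries, centralBinomSeries, coeff_mk, coeff_mk,
    ← succ_mul_catalan_eq_centralBinom]
  push_cast
  ring

/-- With `y = xC`, differentiate `y = x + y²` and use `y' = B`. -/
theorem centralBinomSeries_mul : centralBinomSeries * (1 - 2 * (X * ratCatalanSeries)) = 1 := by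
  have h : X * ratCatalanSeries = X + (X * ratCatalanSeries) ^ 2 := by
    linear_combination X * ratCatalanSeries_eq
  have h' := congrArg (derivative ℚ) h
  rw [map_add, sq, Derivation.leibniz (derivative ℚ) (X * ratCatalanSeries) (X * ratCatalanSeries),
    derivative_X_mul_ratCatalanSeries] at h'
  simp only [derivative_X, smul_eq_mul] at h'
  linear_combination h'

theorem centralBinomSeries_sq : centralBinomSeries ^ 2 * (1 - 4 * X) = 1 := by
  have h := centralBinomSeries_mul
  have hc := ratCatalanSeries_eq
  linear_combination
    (centralBinomSeries * (1 - 2 * (X * ratCatalanSeries)) + 1) * h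
      + 4 * X * centralBinomSeries ^ 2 * hc

local notation "r" => largeSchroderSeries
local notation "d" => delannoySeries

/-- Both sides solve the same quadratic equation. Their difference is annihilated by a series with
constant term 1, so it vanishes. -/
theorem largeSchroderSeries_eq_subst : r = geomSeries * ratCatalanSeries.subst koebeSeries := by
  set R := geomSeries * ratCatalanSeries.subst koebeSeries with hR
  have hC : ratCatalanSeries.subst koebeSeries =
      1 + koebeSeries * ratCatalanSeries.subst koebeSeries ^ 2 := by
    have h := congrArg (substAlgHom hasSubst_koebeSeries) ratCatalanSeries_eq
    simpa only [map_add, map_mul, map_pow, map_one, substAlgHom_X, coe_substAlgHom] using h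
  have hR' : R = 1 + X * R + X * R ^ 2 := by
    have hg := geomSeries_mul
    rw [hR]
    generalize ratCatalanSeries.subst koebeSeries = S at hC
    rw [koebeSeries] at hC
    linear_combination geomSeries * (1 - X) * hC + (1 + X * geomSeries ^ 2 * S ^ 2) * hg
  have h0 : (r - R) * (1 - X - X * (r + R)) = 0 := by
    linear_combination largeSchroderSeries_eq - hR'
  rcases mul_eq_zero.1 h0 with h | h
  · exact sub_eq_zero.1 h
  · have := congrArg (constantCoeff (R := ℚ)) h
    simp at this

theorem delannoySeries_eq_subst : d = geomSeries * centralBinomSeries.subst koebeSeries := by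
  ext n
  rw [coeff_geomSeries_mul_subst_koebeSeries]
  simp only [delannoySeries, centralDelannoy, coeff_mk]
  rw [Nat.cast_sum]
  refine Finset.sum_congr rfl fun k hk => ?_
  rw [Finset.mem_range] at hk
  have h1 := coeff_geomSeries_pow_mul_koebeSeries_pow 1 k n (by omega)
  rw [pow_one] at h1
  rw [h1, centralBinomSeries, coeff_mk, Nat.multichoose_eq,
    show 1 + 2 * k + (n - k) - 1 = n + k by omega, Nat.choose_symm_of_eq_add (n := n + k) (a := n - k) (b := 2 * k) (by omega)]
  -- Trinomial revision: `binom (n+k) (2k) * binom (2k) k = binom (n+k) k * binom n k`.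
  have h2 := Nat.choose_mul (n := n + k) (k := 2 * k) (s := k) (by omega)
  rw [Nat.add_sub_cancel, show 2 * k - k = k by omega] at h2
  rw [Nat.centralBinom]
  exact_mod_cast (by linarith : n.choose k * (n + k).choose k = (2 * k).choose k * (n + k).choose (2 * k))

/-- Substitute `K` in `B (1 - 2xC) = 1` and use `1 - x - 2xr = (1 - x)(1 - 2K C(K))`. -/
theorem delannoySeries_mul : d * (1 - X - 2 * X * r) = 1 := by
  have h := congrArg (substAlgHom hasSubst_koebeSeries) centralBinomSeries_mul
  have h2 : substAlgHom hasSubst_koebeSeries (2 : ℚ⟦X⟧) = 2 := map_ofNat _ 2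
  simp only [map_sub, map_mul, map_one, substAlgHom_X, h2] at h
  have hg := geomSeries_mul
  rw [largeSchroderSeries_eq_subst, delannoySeries_eq_subst,
    ← coe_substAlgHom hasSubst_koebeSeries]
  generalize substAlgHom hasSubst_koebeSeries centralBinomSeries = B at *
  generalize substAlgHom hasSubst_koebeSeries ratCatalanSeries = S at *
  rw [koebeSeries] at h
  linear_combination h + B * hg

/-- The right side is the discriminant of `x r² - (1 - x) r + 1 = 0`. -/
theorem sq_one_sub_X_sub : (1 - X - 2 * X * r) ^ 2 = 1 - 6 * X + X ^ 2 := by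
  linear_combination -4 * X * largeSchroderSeries_eq

/-- After multiplication by `s = 1 - x - 2xr` the claim becomes `1 - r s = x r²`, which is the
quadratic equation of `r`. -/
theorem edgeSeries_eq : edgeSeries SchroderPath = (1 - X) * (d - r) := by
  have h1 := edgeSeries_mul
  have h2 := delannoySeries_mul
  have hr := largeSchroderSeries_eq
  have hs : (1 - X - 2 * X * r) ≠ 0 := fun h => by rw [h] at h2; simp at h2
  apply mul_right_cancel₀ hs
  linear_combination h1 - (1 - X) * h2 + (1 - X) * hr

theorem edgeSeries_closed_form :
    2 * X * (1 - X - 2 * X * r) * edgeSeries SchroderPath =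
      (1 - X) * (1 - 4 * X + X ^ 2 - (1 - X) * (1 - X - 2 * X * r)) := by
  linear_combination 2 * X * edgeSeries_mul - (1 - X) * 2 * X * largeSchroderSeries_eq

theorem edgeCount_zero : (edgeCount (SchroderPath 0) : ℤ) =
    centralDelannoy 0 - Nat.largeSchroder 0 := by
  have h := congrArg (constantCoeff (R := ℚ)) edgeSeries_eq
  simp [edgeSeries, delannoySeries, largeSchroderSeries] at h
  rw [Nat.largeSchroder_zero]
  exact_mod_cast h

theorem edgeCount_succ (n : ℕ) : (edgeCount (SchroderPath (n + 1)) : ℤ) =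
    centralDelannoy (n + 1) - Nat.largeSchroder (n + 1) - centralDelannoy n
      + Nat.largeSchroder n := by
  have h := congrArg (coeff (R := ℚ) (n + 1)) edgeSeries_eq
  rw [sub_mul, one_mul, map_sub, coeff_succ_X_mul] at h
  simp only [edgeSeries, delannoySeries, largeSchroderSeries, coeff_mk, map_sub] at h
  have h' : (edgeCount (SchroderPath (n + 1)) : ℚ) =
    centralDelannoy (n + 1) - Nat.largeSchroder (n + 1) - centralDelannoy n
      + Nat.largeSchroder n := by linear_combination h
  exact_mod_cast h'

theorem edgeSeries_eq_subst : edgeSeries SchroderPath =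
    (centralBinomSeries - ratCatalanSeries).subst koebeSeries := by
  rw [edgeSeries_eq, largeSchroderSeries_eq_subst, delannoySeries_eq_subst,
    ← coe_substAlgHom hasSubst_koebeSeries, map_sub]
  linear_combination (substAlgHom hasSubst_koebeSeries centralBinomSeries
    - substAlgHom hasSubst_koebeSeries ratCatalanSeries) * geomSeries_mul

/-- The `k`-th coefficient of `B - C` is `binom (2k) k * (1 - 1 / (k + 1))`. -/
theorem edgeCount_eq_sum_multichoose (n : ℕ) : (edgeCount (SchroderPath n) : ℚ) =
    ∑ k ∈ Finset.range (n + 1), (Nat.multichoose (2 * k) (n - k) : ℚ) * ((2 * k).choose k : ℚ) *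
      ((k : ℚ) / ((k : ℚ) + 1)) := by
  have h := congrArg (coeff (R := ℚ) n) edgeSeries_eq_subst
  rw [edgeSeries, coeff_mk, coeff_subst_koebeSeries _ le_rfl] at h
  rw [h]
  refine Finset.sum_congr rfl fun k hk => ?_
  rw [Finset.mem_range] at hk
  have h1 := coeff_geomSeries_pow_mul_koebeSeries_pow 0 k n (by omega)
  rw [pow_zero, one_mul, zero_add] at h1
  have h2 : ((k : ℚ) + 1) * catalan k = Nat.centralBinom k := by
    exact_mod_cast succ_mul_catalan_eq_centralBinom k
  rw [h1, map_sub, centralBinomSeries, ratCatalanSeries, coeff_mk, coeff_mk,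
    ← Nat.centralBinom_eq_two_mul_choose, ← h2]
  field_simp
  ring

/-- The derivative of the functional equation links Schröder and Delannoy numbers. -/
theorem two_mul_succ_mul_largeSchroder (n : ℕ) :
    2 * ((n : ℚ) + 2) * Nat.largeSchroder (n + 1) =
      3 * centralDelannoy (n + 1) - centralDelannoy n := by
  have h := congrArg (derivative ℚ) sq_one_sub_X_sub
  have h6 : derivative ℚ (6 : ℚ⟦X⟧) = 0 := by
    simpa using (derivative ℚ).map_natCast 6
  have h2 : derivative ℚ (2 : ℚ⟦X⟧) = 0 := by
    simpa using (derivative ℚ).map_natCast 2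
  -- From `s s' = x - 3` and `d s = 1` follows `s' = (x - 3) d`, while `s' = -1 - 2 (x r)'`.
  have h3 : derivative ℚ (X * r) * 2 + 1 = (3 - X) * d := by
    rw [sq, sq] at h
    simp only [map_sub, map_add, Derivation.leibniz, smul_eq_mul, derivative_X, h6, h2,
      Derivation.map_one_eq_zero] at h
    have hd := delannoySeries_mul
    simp only [Derivation.leibniz, smul_eq_mul, derivative_X]
    have h0 : (2 : ℚ⟦X⟧) ≠ 0 := fun h => by
      rw [← map_ofNat C 2] at h
      simpa using congrArg (constantCoeff (R := ℚ)) h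
    refine mul_left_cancel₀ h0 ?_
    linear_combination -d * h - 2 * (1 + 2 * (X * derivative ℚ r + r)) * hd
  have h4 := congrArg (coeff (R := ℚ) (n + 1)) h3
  rw [map_add, mul_comm _ (2 : ℚ⟦X⟧), sub_mul, map_sub, coeff_succ_X_mul,
    show (2 : ℚ⟦X⟧) = C (2 : ℚ) from (map_ofNat C 2).symm,
    show (3 : ℚ⟦X⟧) = C (3 : ℚ) from (map_ofNat C 3).symm, coeff_C_mul,
    coeff_C_mul, coeff_derivative, coeff_succ_X_mul] at h4
  simp [delannoySeries, largeSchroderSeries, coeff_one] at h4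
  linear_combination h4

end SchroderLattice

/-! ### Central binomial coefficients: limit and uniform bound -/

namespace SchroderLattice

open Topology

/-- The normalized central binomial coefficients `binom (2k) k / 4 ^ k`. -/
noncomputable def wallisCoeff (k : ℕ) : ℝ := (Nat.centralBinom k : ℝ) / 4 ^ k

theorem wallisCoeff_nonneg (k : ℕ) : 0 ≤ wallisCoeff k := by unfold wallisCoeff; positivity

theorem wallisCoeff_le_one (k : ℕ) : wallisCoeff k ≤ 1 := by
  rw [wallisCoeff, div_le_one (by positivity)]
  have h : Nat.centralBinom k ≤ 4 ^ k := by
    rw [Nat.centralBinom, show 4 = 2 ^ 2 by rfl, ← pow_mul]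
    exact Nat.choose_le_two_pow _ _
  exact_mod_cast h

@[simp] theorem wallisCoeff_zero : wallisCoeff 0 = 1 := by simp [wallisCoeff]

theorem wallisCoeff_mul_sqrt (n : ℕ) (hn : n ≠ 0) :
    wallisCoeff n * √n = Stirling.stirlingSeq (2 * n) / Stirling.stirlingSeq n ^ 2 := by
  have hn' : (0 : ℝ) < n := by positivity
  have h1 : (Nat.centralBinom n : ℝ) * ((n.factorial : ℝ) * n.factorial) = (2 * n).factorial := by
    have := Nat.choose_mul_factorial_mul_factorial (show n ≤ 2 * n by omega)
    rw [show 2 * n - n = n by omega, mul_assoc] at this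
    exact_mod_cast this
  have h2 : √(2 * ((2 * n : ℕ) : ℝ)) = 2 * √n := by
    rw [show (2 * ((2 * n : ℕ) : ℝ)) = 2 ^ 2 * n by push_cast; ring, Real.sqrt_mul (by positivity),
      Real.sqrt_sq (by positivity)]
  have h3 : √(2 * (n : ℝ)) ^ 2 = 2 * n := Real.sq_sqrt (by positivity)
  have h4 : √(n : ℝ) ^ 2 = n := Real.sq_sqrt (by positivity)
  have h5 : ((2 * n : ℕ) : ℝ) / Real.exp 1 = 2 * (n / Real.exp 1) := by push_cast; ring
  have h6 : (4 : ℝ) ^ n = 2 ^ (2 * n) := by rw [pow_mul]; norm_num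
  have hf : (n.factorial : ℝ) ≠ 0 := by positivity
  have hs : √(n : ℝ) ≠ 0 := by positivity
  have hq : (n : ℝ) / Real.exp 1 ≠ 0 := by positivity
  rw [Stirling.stirlingSeq, Stirling.stirlingSeq, h2, h5, ← h1, wallisCoeff, h6, div_pow, mul_pow,
    mul_pow, h3]
  generalize (n : ℝ) / Real.exp 1 = q at *
  field_simp
  rw [h4]
  ring

theorem tendsto_wallisCoeff_mul_sqrt :
    Tendsto (fun n : ℕ => wallisCoeff n * √n) atTop (𝓝 (1 / √Real.pi)) := by
  have h := Stirling.tendsto_stirlingSeq_sqrt_pi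
  have hpi : √Real.pi ≠ 0 := by positivity
  have h2 : Tendsto (fun n : ℕ => 2 * n) atTop atTop :=
    tendsto_id.const_mul_atTop' (by norm_num)
  have h3 := (h.comp h2).div (h.pow 2) (by positivity)
  rw [show √Real.pi / √Real.pi ^ 2 = 1 / √Real.pi by field_simp] at h3
  refine h3.congr' ?_
  filter_upwards [eventually_ne_atTop 0] with n hn
  exact (wallisCoeff_mul_sqrt n hn).symm

/-- The domination needed in `tendsto_delannoy`: for `m = n - k ≥ 1`, `√(k + m) ≤ √m * √(k + 1)`,
and `wallisCoeff m * √m` is bounded. -/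
theorem exists_wallisCoeff_mul_sqrt_le :
    ∃ M : ℝ, ∀ n k : ℕ, k ≤ n → wallisCoeff (n - k) * √n ≤ M * √(k + 1) := by
  obtain ⟨M, hM⟩ := tendsto_wallisCoeff_mul_sqrt.bddAbove_range
  -- The 1 covers `n = k`, where `wallisCoeff 0 = 1`.
  refine ⟨max M 1, fun n k hk => ?_⟩
  obtain ⟨m, rfl⟩ := Nat.exists_eq_add_of_le hk
  rw [Nat.add_sub_cancel_left]
  obtain rfl | hm := Nat.eq_zero_or_pos m
  · have : √(k : ℝ) ≤ √(k + 1) := Real.sqrt_le_sqrt (by linarith)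
    have := Real.sqrt_nonneg ((k : ℝ) + 1)
    have := le_max_right M 1
    simp
    nlinarith
  · have h1 : √((k + m : ℕ) : ℝ) ≤ √m * √(k + 1) := by
      rw [← Real.sqrt_mul (by positivity)]
      apply Real.sqrt_le_sqrt
      have : (1 : ℝ) ≤ m := by exact_mod_cast hm
      push_cast
      nlinarith [(Nat.cast_nonneg k : (0 : ℝ) ≤ k)]
    have h2 : wallisCoeff m * √m ≤ M := hM ⟨m, rfl⟩
    calc wallisCoeff m * √((k + m : ℕ) : ℝ) ≤ wallisCoeff m * (√m * √(k + 1)) :=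
          mul_le_mul_of_nonneg_left h1 (wallisCoeff_nonneg m)
      _ = wallisCoeff m * √m * √(k + 1) := by ring
      _ ≤ max M 1 * √(k + 1) :=
          mul_le_mul_of_nonneg_right (h2.trans (le_max_left _ _)) (Real.sqrt_nonneg _)

/-- The generating series of the central binomial coefficients, evaluated at `c * x / 4`. -/
noncomputable def wallisSeries (c : ℝ) : ℝ⟦X⟧ := PowerSeries.mk fun n => wallisCoeff n * c ^ n

theorem wallisSeries_eq (c : ℝ) :
    wallisSeries c = rescale (c / 4) (centralBinomSeries.map (algebraMap ℚ ℝ)) := by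
  ext n
  simp [wallisSeries, wallisCoeff, centralBinomSeries, div_pow]
  ring

theorem wallisSeries_sq_mul (c : ℝ) : wallisSeries c ^ 2 * (1 - C c * X) = 1 := by
  have h := congrArg (fun f => rescale (c / 4) (PowerSeries.map (algebraMap ℚ ℝ) f))
    centralBinomSeries_sq
  simp only [map_mul, map_pow, map_sub, map_one, ← wallisSeries_eq, map_ofNat, map_X,
    rescale_X] at h
  have h4 : (4 : ℝ⟦X⟧) * C (c / 4) = C c := by
    rw [← map_ofNat C 4, ← map_mul]
    congr 1
    ring
  rw [← mul_assoc, h4] at h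
  exact h

theorem sum_wallisCoeff_mul (n : ℕ) :
    ∑ p ∈ Finset.HasAntidiagonal.antidiagonal n, wallisCoeff p.1 * wallisCoeff p.2 = 1 := by
  have h1 : wallisSeries 1 ^ 2 * (1 - X) = (mk 1 : ℝ⟦X⟧) * (1 - X) := by
    rw [mk_one_mul_one_sub_eq_one]
    simpa using wallisSeries_sq_mul 1
  have h0 : (1 - X : ℝ⟦X⟧) ≠ 0 := fun h => by simpa using congrArg (constantCoeff (R := ℝ)) h
  have h2 := congrArg (coeff n) (mul_right_cancel₀ h0 h1)
  rw [sq, coeff_mul] at h2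
  simpa [wallisSeries] using h2

/-! ### Factorization of the Delannoy series over the reals -/

/-- The squared ratio `3 - 2√2` of the two singularities of the Delannoy series. -/
noncomputable def smallRoot : ℝ := 3 - 2 * √2

/-- The growth rate `(1 + √2)²` of the Delannoy numbers. -/
noncomputable def growthRate : ℝ := (1 + √2) ^ 2

theorem growthRate_eq : growthRate = 3 + 2 * √2 := by
  have := Real.sq_sqrt (show (0 : ℝ) ≤ 2 by norm_num)
  rw [growthRate]; linear_combination this

theorem growthRate_mul_smallRoot : growthRate * smallRoot = 1 := by
  have := Real.sq_sqrt (show (0 : ℝ) ≤ 2 by norm_num)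
  rw [growthRate_eq, smallRoot]; linear_combination -4 * this

theorem growthRate_pos : 0 < growthRate := by unfold growthRate; positivity

theorem smallRoot_pos : 0 < smallRoot :=
  pos_of_mul_pos_right (growthRate_mul_smallRoot ▸ one_pos) growthRate_pos.le

theorem smallRoot_lt_one : smallRoot < 1 := by
  have := Real.lt_sqrt_of_sq_lt (show (1 : ℝ) ^ 2 < 2 by norm_num)
  unfold smallRoot; linarith

/-- The rates have sum 6 and product 1, so both sides square to `1 / (1 - 6x + x²)`; the constant
term fixes the sign. -/
theorem map_delannoySeries_eq : delannoySeries.map (algebraMap ℚ ℝ) =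
    wallisSeries growthRate * wallisSeries smallRoot := by
  set D := delannoySeries.map (algebraMap ℚ ℝ) with hD
  have h1 : D ^ 2 * (1 - 6 * X + X ^ 2) = 1 := by
    have h : delannoySeries ^ 2 * (1 - 6 * X + X ^ 2) = 1 := by
      rw [← sq_one_sub_X_sub, ← mul_pow, delannoySeries_mul, one_pow]
    simpa only [map_mul, map_pow, map_sub, map_add, map_one, map_ofNat, map_X] using
      congrArg (PowerSeries.map (algebraMap ℚ ℝ)) h
  have h2 : (wallisSeries growthRate * wallisSeries smallRoot) ^ 2 * (1 - 6 * X + X ^ 2) = 1 := by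
    have hp : C growthRate * C smallRoot = (1 : ℝ⟦X⟧) := by
      rw [← map_mul, growthRate_mul_smallRoot, map_one]
    have hs : C growthRate + C smallRoot = (6 : ℝ⟦X⟧) := by
      rw [← map_add, growthRate_eq, smallRoot, ← map_ofNat C 6]
      congr 1; ring
    have ha := wallisSeries_sq_mul growthRate
    have hb := wallisSeries_sq_mul smallRoot
    generalize wallisSeries growthRate = A at *
    generalize wallisSeries smallRoot = B at *
    linear_combination B ^ 2 * (1 - C smallRoot * X) * ha + hb
      + (A * B) ^ 2 * X * hs - (A * B) ^ 2 * X ^ 2 * hp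
  have h0 : (1 - 6 * X + X ^ 2 : ℝ⟦X⟧) ≠ 0 := fun h => by rw [h] at h1; simp at h1
  obtain h | h := sq_eq_sq_iff_eq_or_eq_neg.1 (mul_right_cancel₀ h0 (h1.trans h2.symm))
  · exact h
  · have := congrArg (coeff (R := ℝ) 0) h
    rw [map_neg, coeff_mul, Finset.Nat.antidiagonal_zero, Finset.sum_singleton] at this
    simp only [hD, delannoySeries, wallisSeries, coeff_map, coeff_mk] at this
    norm_num [centralDelannoy] at this

/-- Since the rates are reciprocal, extracting `growthRate ^ n` turns `smallRoot ^ k` into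
`smallRoot ^ (2k)`. -/
theorem centralDelannoy_eq_sum (n : ℕ) : (centralDelannoy n : ℝ) = growthRate ^ n *
    ∑ k ∈ Finset.range (n + 1), wallisCoeff k * (smallRoot ^ 2) ^ k * wallisCoeff (n - k) := by
  have h := congrArg (coeff n) map_delannoySeries_eq
  rw [mul_comm (wallisSeries _), coeff_mul, Finset.Nat.sum_antidiagonal_eq_sum_range_succ_mk] at h
  simp only [delannoySeries, coeff_map, coeff_mk, wallisSeries] at h
  rw [map_natCast] at h
  rw [h, Finset.mul_sum]
  refine Finset.sum_congr rfl fun k hk => ?_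
  rw [Finset.mem_range] at hk
  have h1 : growthRate ^ n = growthRate ^ (n - k) * growthRate ^ k := by
    rw [← pow_add]; congr 1; omega
  have h2 : growthRate ^ k * smallRoot ^ k = 1 := by
    rw [← mul_pow, growthRate_mul_smallRoot, one_pow]
  rw [h1, ← pow_mul, mul_comm 2 k, pow_mul]
  linear_combination - wallisCoeff k * wallisCoeff (n - k) * smallRoot ^ k
    * growthRate ^ (n - k) * h2

theorem smallRoot_sq_lt_one : smallRoot ^ 2 < 1 :=
  pow_lt_one₀ smallRoot_pos.le smallRoot_lt_one two_ne_zero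

theorem summable_wallisCoeff_mul : Summable fun k => wallisCoeff k * (smallRoot ^ 2) ^ k := by
  refine Summable.of_nonneg_of_le (fun k => ?_) (fun k => ?_)
    (summable_geometric_of_lt_one (sq_nonneg smallRoot) smallRoot_sq_lt_one)
  · have := wallisCoeff_nonneg k; positivity
  · exact mul_le_of_le_one_left (by positivity) (wallisCoeff_le_one k)

/-- The sum is `(1 - smallRoot²) ^ (-1/2)`; the Cauchy product with itself is a geometric series. -/
theorem tsum_wallisCoeff_sq :
    (∑' k, wallisCoeff k * (smallRoot ^ 2) ^ k) ^ 2 * (1 - smallRoot ^ 2) = 1 := by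
  have hn : Summable fun k => ‖wallisCoeff k * (smallRoot ^ 2) ^ k‖ :=
    summable_wallisCoeff_mul.norm
  rw [sq (tsum _), tsum_mul_tsum_eq_tsum_sum_antidiagonal_of_summable_norm hn hn]
  have h (n : ℕ) : ∑ p ∈ Finset.HasAntidiagonal.antidiagonal n,
      wallisCoeff p.1 * (smallRoot ^ 2) ^ p.1 * (wallisCoeff p.2 * (smallRoot ^ 2) ^ p.2) =
      (smallRoot ^ 2) ^ n := by
    rw [← mul_one ((smallRoot ^ 2) ^ n), ← sum_wallisCoeff_mul n, Finset.mul_sum]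
    refine Finset.sum_congr rfl fun p hp => ?_
    rw [← Finset.HasAntidiagonal.mem_antidiagonal.1 hp, pow_add]
    ring
  rw [tsum_congr h, tsum_geometric_of_lt_one (sq_nonneg _) smallRoot_sq_lt_one]
  exact inv_mul_cancel₀ (by linarith [smallRoot_sq_lt_one])

/-! ### Asymptotics of Delannoy, Schröder and edge numbers -/

/-- The comparison sequence `(1 + √2)²ⁿ / √n`. -/
noncomputable def growthSeq (n : ℕ) : ℝ := growthRate ^ n / √n

/-- The limit of `dₙ √n / (1 + √2)²ⁿ`. -/
noncomputable def delannoyConst : ℝ :=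
  (∑' k, wallisCoeff k * (smallRoot ^ 2) ^ k) * (1 / √Real.pi)

/-- Dominated convergence in `k`: each `wallisCoeff (n - k) * √n` tends to `1 / √π`, and the terms
are at most `M (k + 1) smallRoot ^ (2k)`. -/
theorem tendsto_delannoy :
    Tendsto (fun n => (centralDelannoy n : ℝ) / growthSeq n) atTop (𝓝 delannoyConst) := by
  obtain ⟨M, hM⟩ := exists_wallisCoeff_mul_sqrt_le
  have hM0 : 0 ≤ M := by
    have := hM 0 0 le_rfl
    simpa using this
  let f (n k : ℕ) : ℝ :=
    if k ≤ n then wallisCoeff k * (smallRoot ^ 2) ^ k * (wallisCoeff (n - k) * √n) else 0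
  have hf (n : ℕ) : (centralDelannoy n : ℝ) / growthSeq n = ∑' k, f n k := by
    rw [tsum_eq_sum (s := Finset.range (n + 1)) fun k hk => if_neg (by simpa using hk),
      centralDelannoy_eq_sum, growthSeq, div_div_eq_mul_div, mul_assoc,
      mul_div_cancel_left₀ _ (pow_ne_zero _ growthRate_pos.ne'), Finset.sum_mul]
    refine Finset.sum_congr rfl fun k hk => ?_
    rw [Finset.mem_range] at hk
    rw [if_pos (by omega), mul_assoc]
  simp_rw [hf, delannoyConst, ← tsum_mul_right]
  have hsum : Summable fun k : ℕ => M * (((k : ℝ) + 1) * (smallRoot ^ 2) ^ k) := by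
    refine Summable.mul_left _ ?_
    have h1 := summable_pow_mul_geometric_of_norm_lt_one (R := ℝ) 1 (r := smallRoot ^ 2)
      (by rw [Real.norm_of_nonneg (sq_nonneg _)]; exact smallRoot_sq_lt_one)
    have h2 := summable_geometric_of_lt_one (sq_nonneg smallRoot) smallRoot_sq_lt_one
    refine (h1.add h2).congr fun k => ?_
    ring
  refine tendsto_tsum_of_dominated_convergence hsum (fun k => ?_) (.of_forall fun n k => ?_)
  · refine Tendsto.const_mul _ ?_ |>.congr' (f₁ := fun n => wallisCoeff k * (smallRoot ^ 2) ^ k *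
      (wallisCoeff (n - k) * √n)) ?_
    -- Replacing `n` by `n + k`, the factor is `wallisCoeff n * √n` times `√((n + k) / n)`.
    · rw [← tendsto_add_atTop_iff_nat k]
      have h1 : Tendsto (fun n : ℕ => √(((n + k : ℕ) : ℝ) / n)) atTop (𝓝 1) := by
        rw [← Real.sqrt_one]
        refine (Real.continuous_sqrt.tendsto _).comp ?_
        have := (tendsto_const_div_atTop_nhds_zero_nat (k : ℝ)).const_add 1
        rw [add_zero] at this
        refine this.congr' ?_
        filter_upwards [eventually_ne_atTop 0] with n hn
        have : (n : ℝ) ≠ 0 := by exact_mod_cast hn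
        push_cast
        field_simp
      have h2 := tendsto_wallisCoeff_mul_sqrt.mul h1
      rw [mul_one] at h2
      refine h2.congr' ?_
      filter_upwards [eventually_ne_atTop 0] with n hn
      have : (0 : ℝ) < n := by positivity
      rw [Nat.add_sub_cancel, mul_assoc, ← Real.sqrt_mul this.le, mul_div_cancel₀ _ this.ne']
    · filter_upwards [eventually_ge_atTop k] with n hn
      simp only [f]
      rw [if_pos hn]
  · simp only [f]
    split_ifs with hk
    · have hw := wallisCoeff_nonneg k
      have hw' := wallisCoeff_nonneg (n - k)
      rw [Real.norm_of_nonneg (by positivity)]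
      have h1 : √((k : ℝ) + 1) ≤ k + 1 := (Real.sqrt_le_left (by positivity)).2 (by nlinarith [(Nat.cast_nonneg k : (0 : ℝ) ≤ k)])
      calc wallisCoeff k * (smallRoot ^ 2) ^ k * (wallisCoeff (n - k) * √n)
          ≤ 1 * (smallRoot ^ 2) ^ k * (M * (k + 1)) := by
            refine mul_le_mul ?_ ((hM n k hk).trans (mul_le_mul_of_nonneg_left h1 hM0))
              (by positivity) (by positivity)
            exact mul_le_mul_of_nonneg_right (wallisCoeff_le_one k) (by positivity)
        _ = _ := by ring
    · simp only [norm_zero]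
      positivity

theorem delannoyConst_pos : 0 < delannoyConst := by
  have h : 0 ≤ ∑' k, wallisCoeff k * (smallRoot ^ 2) ^ k := tsum_nonneg fun k => by
    have := wallisCoeff_nonneg k; positivity
  have h1 : (∑' k, wallisCoeff k * (smallRoot ^ 2) ^ k) ≠ 0 := fun h0 => by
    have := tsum_wallisCoeff_sq
    rw [h0] at this
    simp at this
  have h2 := lt_of_le_of_ne h h1.symm
  unfold delannoyConst
  positivity

/-- Squaring reduces this to `delannoyConst² π (1 - smallRoot²) = 1`, because `√2 (1 - smallRoot) =
1 + smallRoot`. -/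
theorem delannoyConst_mul : delannoyConst * (1 - smallRoot) * √(√2 * Real.pi) = 1 := by
  have h := tsum_wallisCoeff_sq
  have hpos := delannoyConst_pos
  have hpi : √Real.pi ^ 2 = Real.pi := Real.sq_sqrt Real.pi_pos.le
  have hpi0 : √Real.pi ≠ 0 := by positivity
  have hS : (∑' k, wallisCoeff k * (smallRoot ^ 2) ^ k) ^ 2 = delannoyConst ^ 2 * Real.pi := by
    rw [delannoyConst, mul_pow, div_pow, hpi]
    field_simp
  rw [hS] at h
  have h1 : 0 < 1 - smallRoot := by linarith [smallRoot_lt_one]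
  have h2 : √2 ^ 2 = 2 := Real.sq_sqrt (by norm_num)
  have h3 : √2 * (1 - smallRoot) = 1 + smallRoot := by
    unfold smallRoot; linear_combination 2 * h2
  rw [← sq_eq_sq₀ (by positivity) one_pos.le, mul_pow, Real.sq_sqrt (by positivity)]
  linear_combination h + delannoyConst ^ 2 * Real.pi * (1 - smallRoot) * h3

theorem growthSeq_pos {n : ℕ} (hn : n ≠ 0) : 0 < growthSeq n := by
  have := growthRate_pos
  unfold growthSeq; positivity

theorem tendsto_growthSeq_div :
    Tendsto (fun n => growthSeq n / growthSeq (n + 1)) atTop (𝓝 smallRoot) := by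
  have h1 : Tendsto (fun n : ℕ => √(((n + 1 : ℕ) : ℝ) / n)) atTop (𝓝 1) := by
    rw [← Real.sqrt_one]
    refine (Real.continuous_sqrt.tendsto _).comp ?_
    have := (tendsto_const_div_atTop_nhds_zero_nat (1 : ℝ)).const_add 1
    rw [add_zero] at this
    refine this.congr' ?_
    filter_upwards [eventually_ne_atTop 0] with n hn
    have : (n : ℝ) ≠ 0 := by exact_mod_cast hn
    push_cast
    field_simp
  have h2 := h1.const_mul smallRoot
  rw [mul_one] at h2
  refine h2.congr' ?_
  filter_upwards [eventually_ne_atTop 0] with n hn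
  have hn' : (0 : ℝ) < n := by positivity
  have hg := growthRate_pos
  have := growthRate_mul_smallRoot
  rw [Real.sqrt_div (by positivity), growthSeq, growthSeq, pow_succ]
  have h3 : √((n + 1 : ℕ) : ℝ) ≠ 0 := by positivity
  have h4 : √(n : ℝ) ≠ 0 := by positivity
  field_simp
  linarith

theorem tendsto_delannoy_pred :
    Tendsto (fun n => (centralDelannoy n : ℝ) / growthSeq (n + 1)) atTop
      (𝓝 (delannoyConst * smallRoot)) := by
  refine (tendsto_delannoy.mul tendsto_growthSeq_div).congr' ?_
  filter_upwards [eventually_ne_atTop 0] with n hn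
  have := growthSeq_pos hn
  have := growthSeq_pos n.succ_ne_zero
  field_simp

theorem largeSchroder_succ_eq (n : ℕ) : (Nat.largeSchroder (n + 1) : ℝ) =
    (3 * centralDelannoy (n + 1) - centralDelannoy n) / (2 * (n + 2)) := by
  have h := two_mul_succ_mul_largeSchroder n
  have h' : 2 * ((n : ℝ) + 2) * Nat.largeSchroder (n + 1) =
    3 * centralDelannoy (n + 1) - centralDelannoy n := by exact_mod_cast h
  rw [← h']
  field_simp

/-- The constant arises as `(3 - smallRoot) / 2 = √2`. -/
theorem tendsto_mul_largeSchroder :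
    Tendsto (fun n : ℕ => (n : ℝ) * Nat.largeSchroder n / growthSeq n) atTop
      (𝓝 (delannoyConst * √2)) := by
  rw [← tendsto_add_atTop_iff_nat 1]
  have h1 := (((tendsto_add_atTop_iff_nat 1).2 tendsto_delannoy).const_mul 3).sub
    tendsto_delannoy_pred
  have h2 : Tendsto (fun n : ℕ => ((n : ℝ) + 1) / (n + 2)) atTop (𝓝 1) := by
    have := (tendsto_add_atTop_iff_nat 1).2 (tendsto_natCast_div_add_atTop (1 : ℝ))
    refine this.congr fun n => ?_
    push_cast
    congr 1; ring
  have h3 := (h1.mul h2).mul_const (1 / 2)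
  rw [show (3 * delannoyConst - delannoyConst * smallRoot) * 1 * (1 / 2) = delannoyConst * √2 by
    unfold smallRoot; ring] at h3
  refine h3.congr fun n => ?_
  have := growthSeq_pos n.succ_ne_zero
  rw [largeSchroder_succ_eq]
  push_cast
  field_simp

theorem tendsto_largeSchroder :
    Tendsto (fun n => (Nat.largeSchroder n : ℝ) / growthSeq n) atTop (𝓝 0) := by
  have h := tendsto_mul_largeSchroder.mul tendsto_one_div_atTop_nhds_zero_nat
  rw [mul_zero] at h
  refine h.congr' ?_
  filter_upwards [eventually_ne_atTop 0] with n hn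
  have : (n : ℝ) ≠ 0 := by exact_mod_cast hn
  field_simp

/-- Only `dₙ - dₙ₋₁` contributes, the Schröder terms being smaller by a factor of order `1 / n`. -/
theorem tendsto_edgeCount :
    Tendsto (fun n => (edgeCount (SchroderPath n) : ℝ) / growthSeq n) atTop
      (𝓝 (delannoyConst * (1 - smallRoot))) := by
  rw [← tendsto_add_atTop_iff_nat 1]
  have h1 := (tendsto_add_atTop_iff_nat 1).2 tendsto_delannoy
  have h2 := (tendsto_add_atTop_iff_nat 1).2 tendsto_largeSchroder
  have h3 := tendsto_largeSchroder.mul tendsto_growthSeq_div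
  have h4 := ((h1.sub h2).sub tendsto_delannoy_pred).add h3
  rw [show delannoyConst - 0 - delannoyConst * smallRoot + 0 * smallRoot =
    delannoyConst * (1 - smallRoot) by ring] at h4
  refine h4.congr' ?_
  filter_upwards [eventually_ne_atTop 0] with n hn
  have := growthSeq_pos hn
  have := growthSeq_pos n.succ_ne_zero
  have he : (edgeCount (SchroderPath (n + 1)) : ℝ) =
    centralDelannoy (n + 1) - Nat.largeSchroder (n + 1) - centralDelannoy n
      + Nat.largeSchroder n := by exact_mod_cast edgeCount_succ n
  rw [he]
  field_simp

theorem edgeCount_isEquivalent :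
    (fun n : ℕ => (edgeCount (SchroderPath n) : ℝ)) ~[atTop]
      fun n : ℕ => (1 + √2) ^ (2 * n) / √(√2 * (n : ℝ) * Real.pi) := by
  refine isEquivalent_of_tendsto_one ?_
  have h := tendsto_edgeCount.mul_const √(√2 * Real.pi)
  rw [delannoyConst_mul] at h
  refine h.congr' ?_
  filter_upwards [eventually_ne_atTop 0] with n hn
  have hn' : (0 : ℝ) < n := by positivity
  have hg : 0 < growthRate ^ n := pow_pos growthRate_pos n
  rw [Pi.div_apply, show √2 * (n : ℝ) * Real.pi = √2 * Real.pi * n by ring,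
    Real.sqrt_mul (x := √2 * Real.pi) (by positivity), pow_mul, growthSeq, ← growthRate]
  have : √(n : ℝ) ≠ 0 := by positivity
  field_simp

/-- `delannoyConst` cancels in the quotient of the two limits, leaving `(1 - smallRoot) / √2 = 2 -
√2`. -/
theorem hasseIndex_isEquivalent :
    (fun n : ℕ => hasseIndex (SchroderPath n)) ~[atTop] fun n : ℕ => (2 - √2) * (n : ℝ) := by
  have h2 : √2 ^ 2 = 2 := Real.sq_sqrt (by norm_num)
  have hlt : √2 < 2 := by nlinarith [Real.sqrt_nonneg 2]
  have hpos := delannoyConst_pos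
  refine isEquivalent_of_tendsto_one ?_
  have h := (tendsto_edgeCount.div tendsto_mul_largeSchroder (by positivity)).mul_const
    (1 / (2 - √2))
  rw [show delannoyConst * (1 - smallRoot) / (delannoyConst * √2) * (1 / (2 - √2)) = 1 by
    have : 2 - √2 ≠ 0 := by linarith
    unfold smallRoot
    field_simp
    linear_combination h2] at h
  refine h.congr' ?_
  filter_upwards [eventually_ne_atTop 0] with n hn
  have hn' : (n : ℝ) ≠ 0 := by exact_mod_cast hn
  have := growthSeq_pos hn
  simp only [Pi.div_apply, hasseIndex, card_schroderPath, card_words]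
  field_simp

theorem isAsymptoticallyQuasiBoolean : IsAsymptoticallyQuasiBoolean SchroderPath := by
  have h2 : √2 ^ 2 = 2 := Real.sq_sqrt (by norm_num)
  have h0 := Real.sqrt_nonneg 2
  -- Here `2 - √2 = 1/2 + c` with `c = 3/2 - √2 ≈ 0.086`.
  refine ⟨3 / 2 - √2, by nlinarith, by nlinarith, .inl ?_⟩
  convert hasseIndex_isEquivalent using 3
  ring

end SchroderLattice

theorem mainTheorem5 :
    (SchroderLattice.edgeSeries SchroderLattice.SchroderPath =
      (1 - X) * (SchroderLattice.delannoySeries - SchroderLattice.largeSchroderSeries)) ∧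
    -- closed form, with `s` the square root of `1 - 6x + x²` that has constant term `1`
    (∃ s : ℚ⟦X⟧, s ^ 2 = 1 - 6 * X + X ^ 2 ∧ constantCoeff s = 1 ∧
      2 * X * s * SchroderLattice.edgeSeries SchroderLattice.SchroderPath =
        (1 - X) * (1 - 4 * X + X ^ 2 - (1 - X) * s)) ∧
    -- the case `n = 0` reads `d₋₁ = r₋₁ = 0`
    ((SchroderLattice.edgeCount (SchroderLattice.SchroderPath 0) : ℤ) =
        SchroderLattice.centralDelannoy 0 - Nat.largeSchroder 0 ∧
      ∀ n : ℕ, 1 ≤ n →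
        (SchroderLattice.edgeCount (SchroderLattice.SchroderPath n) : ℤ) =
          SchroderLattice.centralDelannoy n - Nat.largeSchroder n
            - SchroderLattice.centralDelannoy (n - 1) + Nat.largeSchroder (n - 1)) ∧
    (∀ n : ℕ,
      (SchroderLattice.edgeCount (SchroderLattice.SchroderPath n) : ℚ) =
        ∑ k ∈ Finset.range (n + 1),
          (Nat.multichoose (2 * k) (n - k) : ℚ) * ((2 * k).choose k : ℚ) *
            ((k : ℚ) / ((k : ℚ) + 1))) ∧
    ((fun n : ℕ => (SchroderLattice.edgeCount (SchroderLattice.SchroderPath n) : ℝ)) ~[atTop]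
      fun n : ℕ => (1 + √2) ^ (2 * n) / √(√2 * (n : ℝ) * Real.pi)) ∧
    ((fun n : ℕ => SchroderLattice.hasseIndex (SchroderLattice.SchroderPath n)) ~[atTop]
      fun n : ℕ => (2 - √2) * (n : ℝ)) ∧
    SchroderLattice.IsAsymptoticallyQuasiBoolean SchroderLattice.SchroderPath := by
  -- The square root left to unification is `1 - X - 2 * X * r`.
  refine ⟨SchroderLattice.edgeSeries_eq, ⟨_, SchroderLattice.sq_one_sub_X_sub, by simp,
    SchroderLattice.edgeSeries_closed_form⟩, ⟨SchroderLattice.edgeCount_zero, fun n hn => ?_⟩,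
    SchroderLattice.edgeCount_eq_sum_multichoose, SchroderLattice.edgeCount_isEquivalent,
    SchroderLattice.hasseIndex_isEquivalent, SchroderLattice.isAsymptoticallyQuasiBoolean⟩
  obtain ⟨m, rfl⟩ := Nat.exists_eq_add_of_le' hn
  exact SchroderLattice.edgeCount_succ m
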